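/- Let $d_A, d_B$ be positive integers, $D = \max\{d_A,d_B\}$ and $d = \min\{d_A,d_B\}$. Let $\rho$ be a separable state on $\mathbb{C}^{d_A}\otimes\mathbb{C}^{d_B}$, i.e. a finite convex combination of tensor products of density matrices, and suppose that $\rho$ is in Filter Normal Form: $\operatorname{tr}(\rho\,(A\otimes \mathbb{1})) = 0$ and $\operatorname{tr}(\rho\,(\mathbb{1}\otimes B)) = 0$ for all traceless Hermitian $d_A\times d_A$ matrices $A$ and all traceless Hermitian $d_B\times d_B$ matrices $B$. Let $\{A_i\}_{i=1}^{d_A^2}$ and $\{B_j\}_{j=1}^{d_B^2}$ be any orthonormal bases, with respect to the Hilbert–Schmidt inner product $\operatorname{tr}(XY)$, of the real vector spaces of Hermitian $d_A\times d_A$ and $d_B\times d_B$ matrices, and let $\mathcal{C}$ be the correlation matrix $\mathcal{C}_{ij} = \operatorname{tr}(\rho\, A_i\otimes B_j)$. For an integer $1\le h\le d^2$ let $C_h(\mathcal{C})$ be the $h$-th compound matrix of $\mathcal{C}$, i.e. the matrix of all $h\times h$ minors of $\mathcal{C}$, and let $\mathcal{M}_{h,\infty} = \lVert C_h(\mathcal{C})\rVert_\infty$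 be its Schatten $\infty$-norm, i.e. its largest singular value. If $h \ge \sqrt{Dd}$, then $$\mathcal{M}_{h,\infty} \;\le\; \frac{1}{\sqrt{Dd}}\left[\frac{D-1}{D(h-1)}\cdot\frac{d-1}{d(h-1)}\right]^{\frac{h-1}{2}},$$ where in the degenerate case $h=1$ (which forces $D=d=1$) the power with exponent $0$ is read as $1$. -/

import Mathlib

open scoped Kronecker ENNReal ComplexOrder

noncomputable section

/-! ### Quantum states -/

/-- A state (density matrix): a positive semidefinite complex matrix of trace one. -/
def IsState {ι : Type*} [Fintype ι] (ρ : Matrix ι ι ℂ) : Prop :=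
  ρ.PosSemidef ∧ ρ.trace = 1

/-- A bipartite state on `ℂ^dA ⊗ ℂ^dB` is separable if it is a finite convex combination of
product states. -/
def IsSeparableState {dA dB : ℕ} (ρ : Matrix (Fin dA × Fin dB) (Fin dA × Fin dB) ℂ) : Prop :=
  ∃ (n : ℕ) (p : Fin n → ℝ) (O : Fin n → Matrix (Fin dA) (Fin dA) ℂ)
    (Q : Fin n → Matrix (Fin dB) (Fin dB) ℂ),
    (∀ k, 0 ≤ p k) ∧ ∑ k, p k = 1 ∧ (∀ k, IsState (O k)) ∧ (∀ k, IsState (Q k)) ∧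
      ρ = ∑ k, (p k : ℂ) • (O k ⊗ₖ Q k)

/-- The expectation value `⟨X⟩_ρ = tr (ρ X)`. -/
def expectation {ι : Type*} [Fintype ι] (ρ X : Matrix ι ι ℂ) : ℂ :=
  (ρ * X).trace

/-- Filter Normal Form: all traceless local observables of either party have vanishing
expectation value. -/
def IsFNF {dA dB : ℕ} (ρ : Matrix (Fin dA × Fin dB) (Fin dA × Fin dB) ℂ) : Prop :=
  (∀ A : Matrix (Fin dA) (Fin dA) ℂ, A.IsHermitian → A.trace = 0 →
      expectation ρ (A ⊗ₖ (1 : Matrix (Fin dB) (Fin dB) ℂ)) = 0) ∧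
  (∀ B : Matrix (Fin dB) (Fin dB) ℂ, B.IsHermitian → B.trace = 0 →
      expectation ρ ((1 : Matrix (Fin dA) (Fin dA) ℂ) ⊗ₖ B) = 0)

/-! ### The correlation matrix -/

/-- `A` is an orthonormal basis of the real vector space of Hermitian `d × d` matrices with
respect to the Hilbert-Schmidt inner product `tr (X Y)`. -/
def IsHermitianONB {d : ℕ} (A : Fin (d ^ 2) → Matrix (Fin d) (Fin d) ℂ) : Prop :=
  (∀ i, (A i).IsHermitian) ∧
  (∀ i j, (A i * A j).trace = if i = j then 1 else 0) ∧
  Submodule.span ℝ (Set.range A) = selfAdjoint.submodule ℝ (Matrix (Fin d) (Fin d) ℂ)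

/-- The correlation matrix `C i j = ⟨A i ⊗ B j⟩_ρ`. This number is real when `ρ`, `A i` and `B j`
are Hermitian, so that taking the real part loses nothing. -/
def correlationMatrix {dA dB : ℕ} (ρ : Matrix (Fin dA × Fin dB) (Fin dA × Fin dB) ℂ)
    (A : Fin (dA ^ 2) → Matrix (Fin dA) (Fin dA) ℂ)
    (B : Fin (dB ^ 2) → Matrix (Fin dB) (Fin dB) ℂ) :
    Matrix (Fin (dA ^ 2)) (Fin (dB ^ 2)) ℝ :=
  Matrix.of fun i j => (expectation ρ (A i ⊗ₖ B j)).re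

/-! ### Compound matrices, Schatten norms, Correlation Minor Norms -/

/-- The `h`-th compound matrix: the matrix of all `h × h` minors, with rows and columns indexed by
the `h`-element subsets of the row and column index sets. -/
def compoundMatrix {m n : ℕ} (h : ℕ) (M : Matrix (Fin m) (Fin n) ℝ) :
    Matrix {R : Finset (Fin m) // R.card = h} {S : Finset (Fin n) // S.card = h} ℝ :=
  Matrix.of fun R S =>
    (M.submatrix (R.1.orderEmbOfFin R.2) (S.1.orderEmbOfFin S.2)).det

/-- The `k`-th singular value (from `k = 0`, in non-increasing order) of a real matrix. -/
def matrixSingularValue {m n : Type*} [Fintype m] [Fintype n] [DecidableEq n]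
    (M : Matrix m n ℝ) (k : ℕ) : ℝ :=
  (Matrix.toEuclideanLin M).singularValues k

/-- The Schatten `p`-norm: the `ℓ^p` norm of the vector of singular values (their maximum when
`p = ∞`). -/
def schattenNorm {m n : Type*} [Fintype m] [Fintype n] [DecidableEq n]
    (p : ℝ≥0∞) (M : Matrix m n ℝ) : ℝ :=
  ‖WithLp.toLp p
    (fun k : Fin (min (Fintype.card m) (Fintype.card n)) => matrixSingularValue M k)‖

/-- The Correlation Minor Norm `M_{h,p}`: the Schatten `p`-norm of the `h`-th compound matrix of
the correlation matrix. -/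
def correlationMinorNorm {dA dB : ℕ} (h : ℕ) (p : ℝ≥0∞)
    (ρ : Matrix (Fin dA × Fin dB) (Fin dA × Fin dB) ℂ)
    (A : Fin (dA ^ 2) → Matrix (Fin dA) (Fin dA) ℂ)
    (B : Fin (dB ^ 2) → Matrix (Fin dB) (Fin dB) ℂ) : ℝ :=
  schattenNorm p (compoundMatrix h (correlationMatrix ρ A B))

end

/-! The correlation matrix of a separable state `∑ k, p k • O k ⊗ Q k` in filter normal form splits
as `M = s ⊗ t + ∑ k, p k • a k ⊗ b k`, where `s` and `t` are the coordinate vectors of the maximally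
mixed states and `a k ⟂ s`, `b k ⟂ t` are the Bloch vectors of `O k` and `Q k`: the normal form says
that the cross terms vanish (`correlationMatrix_apply_of_isFNF`). Hence `c = ‖s‖ ‖t‖ = 1 / √(D d)` is
a singular value of `M`. By Parseval's identity, and since states have purity at most one,
`‖a k‖² ≤ 1 - 1 / dA` and `‖b k‖² ≤ 1 - 1 / dB`, so the singular values of `M` other than `c` add up
to at most `K = √((1 - 1 / D) (1 - 1 / d))` (`sum_sqrt_eigenvalues_le`).

By the Cauchy–Binet formula the compound of a product is the product of the compounds, so the
singular values of the `h`-th compound are the products of `h` singular values of `M`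
(`schattenNorm_top_compoundMatrix_le`). A product with `c` among its factors is at most
`c (K / (h - 1)) ^ (h - 1)` by the inequality of arithmetic and geometric means. A product of `h`
other singular values has a factor at most `K / h ≤ 1 / √(D d) = c`, this being where `h ≥ √(D d)`
enters, and the same bound follows (`prod_le_mul_div_pow`). -/

/-! ### Compound matrices: the Cauchy–Binet formula and functoriality -/

/-- The **Cauchy–Binet formula**: the determinant of a product of an `h × n` and an `n × h` matrix
is the sum, over all `h`-element sets of inner indices, of the products of the corresponding
maximal minors. -/
theorem Matrix.det_mul_eq_sum_minors {R : Type*} [CommRing R] {n h : ℕ}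
    (M : Matrix (Fin h) (Fin n) R) (N : Matrix (Fin n) (Fin h) R) :
    (M * N).det = ∑ S : {S : Finset (Fin n) // S.card = h},
      (M.submatrix id (S.1.orderEmbOfFin S.2)).det *
        (N.submatrix (S.1.orderEmbOfFin S.2) id).det := by
  classical
  -- Expand every row of `M * N` as a combination of rows of `N`.
  have expand : (M * N).det =
      ∑ f : Fin h → Fin n, (∏ i, M i (f i)) * (N.submatrix f id).det := by
    have hrow : (M * N) = fun i => ∑ j, M i j • N j := by
      ext i j
      simp [Matrix.mul_apply, Finset.sum_apply]
    have := (Matrix.detRowAlternating (R := R) (n := Fin h)).toMultilinearMap.map_sum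
      (fun i j => M i j • N j)
    rw [hrow]
    refine this.trans (Finset.sum_congr rfl fun f _ => ?_)
    exact (Matrix.detRowAlternating (R := R) (n := Fin h)).toMultilinearMap.map_smul_univ _ _
  have hdet : ∀ S : {S : Finset (Fin n) // S.card = h},
      (M.submatrix id (S.1.orderEmbOfFin S.2)).det *
        (N.submatrix (S.1.orderEmbOfFin S.2) id).det =
      ∑ σ : Equiv.Perm (Fin h), (∏ i, M i (S.1.orderEmbOfFin S.2 (σ i))) *
        (N.submatrix (S.1.orderEmbOfFin S.2 ∘ σ) id).det := by
    intro S
    rw [← Matrix.det_transpose, Matrix.det_apply', Finset.sum_mul]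
    refine Finset.sum_congr rfl fun σ _ => ?_
    have h1 : (N.submatrix (S.1.orderEmbOfFin S.2 ∘ σ) id).det =
        (Equiv.Perm.sign σ : ℤ) * (N.submatrix (S.1.orderEmbOfFin S.2) id).det :=
      Matrix.det_permute σ (N.submatrix (S.1.orderEmbOfFin S.2) id)
    rw [h1]
    simp only [Matrix.transpose_apply, Matrix.submatrix_apply, id]
    ring
  -- Only injective choices of rows contribute, and those are pairs of a set and a permutation.
  have hinj : ∑ f : Fin h → Fin n, (∏ i, M i (f i)) * (N.submatrix f id).det =
      ∑ f : Fin h → Fin n with Function.Injective f,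
        (∏ i, M i (f i)) * (N.submatrix f id).det := by
    refine (Finset.sum_subset (Finset.filter_subset _ _) fun f _ hf => ?_).symm
    have hf' : ¬ Function.Injective f := by simpa using hf
    obtain ⟨i, j, hij, hne⟩ : ∃ i j, f i = f j ∧ i ≠ j := by
      simpa [Function.Injective] using hf'
    rw [Matrix.det_zero_of_row_eq hne, mul_zero]
    ext k
    simp [hij]
  rw [expand, hinj, Finset.sum_congr rfl fun S _ => hdet S, ← Finset.sum_product']
  symm
  refine Finset.sum_bij (fun q _ => q.1.1.orderEmbOfFin q.1.2 ∘ q.2) ?_ ?_ ?_ ?_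
  · intro q _
    simpa using (q.1.1.orderEmbOfFin q.1.2).injective.comp q.2.injective
  · rintro ⟨⟨S, hS⟩, σ⟩ _ ⟨⟨S', hS'⟩, σ'⟩ _ heq
    simp only at heq
    have hSS : S = S' := by
      have h1 : Set.range (S.orderEmbOfFin hS ∘ σ) = S := by
        rw [σ.surjective.range_comp, Finset.range_orderEmbOfFin]
      have h2 : Set.range (S'.orderEmbOfFin hS' ∘ σ') = S' := by
        rw [σ'.surjective.range_comp, Finset.range_orderEmbOfFin]
      rw [heq, h2] at h1
      exact_mod_cast h1.symm
    subst hSS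
    have : σ = σ' := by
      ext i : 1
      simpa using congrFun heq i
    rw [this]
  · intro f hf
    have hf : Function.Injective f := by simpa using hf
    have hS : (Finset.univ.image f).card = h := by
      rw [Finset.card_image_of_injective _ hf, Finset.card_univ, Fintype.card_fin]
    let g : Fin h → Fin h := fun i => ((Finset.univ.image f).orderIsoOfFin hS).symm
      ⟨f i, Finset.mem_image_of_mem f (Finset.mem_univ i)⟩
    have hg : Function.Injective g := by
      intro i j hij
      have := ((Finset.univ.image f).orderIsoOfFin hS).symm.injective hij
      exact hf (by simpa using this)
    refine ⟨(⟨_, hS⟩, Equiv.ofBijective g (Finite.injective_iff_bijective.1 hg)), by simp, ?_⟩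
    ext i
    simp [g, ← Finset.coe_orderIsoOfFin_apply]
  · intro q _
    rfl

theorem compoundMatrix_mul {l m n : ℕ} (h : ℕ) (M : Matrix (Fin l) (Fin m) ℝ)
    (N : Matrix (Fin m) (Fin n) ℝ) :
    compoundMatrix h (M * N) = compoundMatrix h M * compoundMatrix h N := by
  ext R S
  simp only [compoundMatrix, Matrix.of_apply, Matrix.mul_apply]
  rw [Matrix.submatrix_mul _ _ _ id _ Function.bijective_id, Matrix.det_mul_eq_sum_minors]
  simp only [Matrix.submatrix_submatrix, Function.comp_id, Function.id_comp]

theorem compoundMatrix_transpose {m n : ℕ} (h : ℕ) (M : Matrix (Fin m) (Fin n) ℝ) :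
    compoundMatrix h M.transpose = (compoundMatrix h M).transpose := by
  ext R S
  simp only [compoundMatrix, Matrix.of_apply, Matrix.transpose_apply]
  rw [← Matrix.det_transpose, Matrix.transpose_submatrix, Matrix.transpose_transpose]

theorem compoundMatrix_diagonal {n : ℕ} (h : ℕ) (l : Fin n → ℝ) :
    compoundMatrix h (Matrix.diagonal l) =
      Matrix.diagonal fun S : {S : Finset (Fin n) // S.card = h} => ∏ i ∈ S.1, l i := by
  ext R S
  simp only [compoundMatrix, Matrix.of_apply]
  by_cases hRS : R = S
  · subst hRS
    rw [Matrix.submatrix_diagonal _ _ (R.1.orderEmbOfFin R.2).injective,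
      Matrix.det_diagonal]
    refine Eq.trans ?_ (Matrix.diagonal_apply_eq _ R).symm
    conv_rhs => rw [← Finset.map_orderEmbOfFin_univ R.1 R.2, Finset.prod_map]
    rfl
  · rw [Matrix.diagonal_apply_ne _ hRS]
    -- As `R` and `S` have the same size, some row index in `R` is missing from `S`.
    have hsub : ¬ R.1 ⊆ S.1 := fun hsub =>
      hRS (Subtype.ext (Finset.eq_of_subset_of_card_le hsub (by rw [R.2, S.2])))
    obtain ⟨r, hrR, hrS⟩ := Finset.not_subset.1 hsub
    obtain ⟨i, rfl⟩ : r ∈ Set.range (R.1.orderEmbOfFin R.2) := by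
      rw [Finset.range_orderEmbOfFin]; exact hrR
    refine Matrix.det_eq_zero_of_row_eq_zero i fun j => ?_
    rw [Matrix.submatrix_apply, Matrix.diagonal_apply_ne]
    intro heq
    exact hrS (heq ▸ Finset.orderEmbOfFin_mem S.1 S.2 j)

theorem compoundMatrix_one {n : ℕ} (h : ℕ) :
    compoundMatrix h (1 : Matrix (Fin n) (Fin n) ℝ) = 1 := by
  rw [← Matrix.diagonal_one, compoundMatrix_diagonal]
  simp

/-! ### Singular values of compound matrices -/

/-- If `b` bounds every product of `h` singular values of `M` (the square roots of the eigenvalues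
`l` of `Mᵀ M`), then `b` bounds the largest singular value of the `h`-th compound matrix: by
functoriality, an orthonormal eigenbasis of `Mᵀ M` gives one of the compound of `Mᵀ M`, whose
eigenvalues are the products of `h` of the `l i`. -/
theorem schattenNorm_top_compoundMatrix_le {m n : ℕ} (h : ℕ) (M : Matrix (Fin m) (Fin n) ℝ)
    (v : OrthonormalBasis (Fin n) ℝ (EuclideanSpace ℝ (Fin n))) (l : Fin n → ℝ)
    (hv : ∀ i, (LinearMap.adjoint (Matrix.toEuclideanLin M)) (Matrix.toEuclideanLin M (v i)) =
      l i • v i)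
    (b : ℝ) (hb : 0 ≤ b)
    (hprod : ∀ S : Finset (Fin n), S.card = h → ∏ i ∈ S, l i ≤ b ^ 2) :
    schattenNorm ⊤ (compoundMatrix h M) ≤ b := by
  let V : Matrix (Fin n) (Fin n) ℝ := Matrix.of fun j i => v i j
  have hVV : V.transpose * V = 1 := by
    ext i j
    have := orthonormal_iff_ite.1 v.orthonormal i j
    rw [Matrix.one_apply, ← this]
    simp [V, Matrix.mul_apply, PiLp.inner_apply, mul_comm]
  have hVV' : V * V.transpose = 1 := mul_eq_one_comm.1 hVV
  have hMV : M.transpose * M * V = V * Matrix.diagonal l := by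
    ext j i
    have h1 := congrArg (fun x : EuclideanSpace ℝ (Fin n) => x j) (hv i)
    rw [← Matrix.toEuclideanLin_conjTranspose_eq_adjoint] at h1
    simp only [Matrix.conjTranspose_eq_transpose_of_trivial, Matrix.toLpLin_apply,
      PiLp.smul_apply, smul_eq_mul] at h1
    rw [Matrix.mulVec_mulVec] at h1
    rw [Matrix.mul_diagonal]
    simp only [Matrix.mul_apply_eq_vecMul, V, Matrix.of_apply]
    rw [mul_comm (v i j), ← h1, ← Matrix.mul_apply_eq_vecMul]
    rfl
  set N := compoundMatrix h M with hN
  set W := compoundMatrix h V with hW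
  have hWW' : W * W.transpose = 1 := by
    rw [hW, ← compoundMatrix_transpose, ← compoundMatrix_mul, hVV', compoundMatrix_one]
  have hWW : W.transpose * W = 1 := mul_eq_one_comm.1 hWW'
  have hNW : N.transpose * N * W = W * Matrix.diagonal
      fun S : {S : Finset (Fin n) // S.card = h} => ∏ i ∈ S.1, l i := by
    rw [hN, hW, ← compoundMatrix_transpose, ← compoundMatrix_mul, ← compoundMatrix_mul, hMV,
      compoundMatrix_mul, compoundMatrix_diagonal]
  have hsv : ∀ k, matrixSingularValue N k ≤ b := by
    intro k
    unfold matrixSingularValue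
    by_cases hk : Module.finrank ℝ
        (EuclideanSpace ℝ {S : Finset (Fin n) // S.card = h}) ≤ k
    · rw [LinearMap.singularValues_of_finrank_le _ hk]
      exact hb
    push Not at hk
    obtain ⟨x, hx⟩ := ((Matrix.toEuclideanLin N).hasEigenvalue_adjoint_comp_self_sq_singularValues
      hk).exists_hasEigenvector
    set s := (Matrix.toEuclideanLin N).singularValues k
    have hx0 : x ≠ 0 := hx.2
    have hxe := hx.apply_eq_smul
    rw [LinearMap.comp_apply, ← Matrix.toEuclideanLin_conjTranspose_eq_adjoint] at hxe
    have hxe' : (N.transpose * N).mulVec x.ofLp = s ^ 2 • x.ofLp := by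
      have := congrArg WithLp.ofLp hxe
      simpa [Matrix.conjTranspose_eq_transpose_of_trivial, Matrix.toLpLin_apply,
        Matrix.mulVec_mulVec] using this
    -- In the coordinates given by `W`, the eigenvector equation becomes diagonal.
    obtain ⟨y, hxy⟩ : ∃ y, x.ofLp = W.mulVec y :=
      ⟨W.transpose.mulVec x.ofLp, by simp [Matrix.mulVec_mulVec, hWW']⟩
    have hy : (Matrix.diagonal
        fun S : {S : Finset (Fin n) // S.card = h} => ∏ i ∈ S.1, l i).mulVec y = s ^ 2 • y := by
      have h2 := congrArg W.transpose.mulVec hxe'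
      rw [Matrix.mulVec_smul] at h2
      rw [hxy, Matrix.mulVec_mulVec _ _ W, hNW, Matrix.mulVec_mulVec, ← Matrix.mul_assoc, hWW,
        Matrix.one_mul, Matrix.mulVec_mulVec, hWW, Matrix.one_mulVec] at h2
      exact h2
    have hy0 : y ≠ 0 := by
      intro h0
      apply hx0
      ext i
      rw [hxy, h0]
      simp
    obtain ⟨S, hS⟩ := Function.ne_iff.1 hy0
    have h3 := congrFun hy S
    rw [Matrix.mulVec_diagonal, Pi.smul_apply, smul_eq_mul] at h3
    have h4 : s ^ 2 = ∏ i ∈ S.1, l i := (mul_right_cancel₀ hS h3).symm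
    exact le_of_sq_le_sq (h4 ▸ hprod S.1 S.2) hb
  unfold schattenNorm
  rw [PiLp.norm_toLp]
  refine (pi_norm_le_iff_of_nonneg hb).2 fun k => ?_
  have hnonneg : 0 ≤ matrixSingularValue N k := LinearMap.singularValues_nonneg _ _
  rw [Real.norm_of_nonneg hnonneg]
  exact hsv _

/-! ### Products of singular values from a trace norm bound -/

theorem Finset.prod_le_sum_div_card_pow {ι : Type*} (S : Finset ι) (z : ι → ℝ)
    (hz : ∀ i ∈ S, 0 ≤ z i) :
    ∏ i ∈ S, z i ≤ ((∑ i ∈ S, z i) / S.card) ^ S.card := by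
  rcases S.eq_empty_or_nonempty with rfl | hS
  · simp
  have hc : (S.card : ℝ) ≠ 0 := by exact_mod_cast hS.card_ne_zero
  have key := Real.geom_mean_le_arith_mean_weighted S (fun _ => (S.card : ℝ)⁻¹) z
    (fun i _ => by positivity) (by simp [hc]) hz
  have h0 : 0 ≤ ∏ i ∈ S, z i ^ ((S.card : ℝ)⁻¹) :=
    Finset.prod_nonneg fun i hi => Real.rpow_nonneg (hz i hi) _
  have h1 := pow_le_pow_left₀ h0 key S.card
  rw [← Finset.prod_pow, ← Finset.mul_sum] at h1
  rw [div_eq_inv_mul]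
  refine le_trans (le_of_eq (Finset.prod_congr rfl fun i hi => ?_)) h1
  rw [← Real.rpow_natCast, ← Real.rpow_mul (hz i hi), inv_mul_cancel₀ hc, Real.rpow_one]

/-- If the value `c` occurs among nonnegative numbers of total at most `c + K`, where `K ≤ c h`,
then a product of `h` of these numbers is largest when it contains `c` and the other factors are
equal. -/
theorem prod_le_mul_div_pow {ι : Type*} [Fintype ι] (z : ι → ℝ)
    (hz : ∀ i, 0 ≤ z i) (c K : ℝ) (i₀ : ι) (hi₀ : z i₀ = c) (hsum : ∑ i, z i ≤ c + K) (h : ℕ)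
    (hh : 1 ≤ h) (hK : K ≤ c * h) (S : Finset ι) (hS : S.card = h) :
    ∏ i ∈ S, z i ≤ c * (K / ((h : ℝ) - 1)) ^ (h - 1) := by
  classical
  have hrest : ∀ U : Finset ι, i₀ ∉ U → ∑ i ∈ U, z i ≤ K := by
    intro U hU
    have h1 : ∑ i ∈ insert i₀ U, z i ≤ ∑ i, z i :=
      Finset.sum_le_sum_of_subset_of_nonneg (Finset.subset_univ _) fun i _ _ => hz i
    rw [Finset.sum_insert hU, hi₀] at h1
    linarith
  -- Some factor is at most `c`, while the remaining ones have sum at most `K`.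
  obtain ⟨j, hjS, hjc, hjK⟩ : ∃ j ∈ S, z j ≤ c ∧ ∑ i ∈ S.erase j, z i ≤ K := by
    by_cases hmem : i₀ ∈ S
    · exact ⟨i₀, hmem, hi₀.le, hrest _ (Finset.notMem_erase _ _)⟩
    · have hne : S.Nonempty := Finset.card_pos.1 (by omega)
      obtain ⟨j, hj, hjc⟩ := Finset.exists_le_of_sum_le (f := z) (g := fun _ => c) hne (by
        rw [Finset.sum_const, hS, nsmul_eq_mul, mul_comm]
        exact (hrest S hmem).trans hK)
      exact ⟨j, hj, hjc, hrest _ fun hm => hmem (Finset.mem_of_mem_erase hm)⟩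
  have hcard : (S.erase j).card = h - 1 := by rw [Finset.card_erase_of_mem hjS, hS]
  have hcast : (((h - 1 : ℕ) : ℝ)) = (h : ℝ) - 1 := by push_cast [hh]; rfl
  have hamgm := Finset.prod_le_sum_div_card_pow (S.erase j) z fun i _ => hz i
  rw [hcard, hcast] at hamgm
  have hh' : (0 : ℝ) ≤ (h : ℝ) - 1 := by rw [← hcast]; positivity
  rw [← Finset.mul_prod_erase S z hjS]
  refine mul_le_mul hjc (hamgm.trans ?_) (Finset.prod_nonneg fun i _ => hz i)
    ((hz j).trans hjc)
  refine pow_le_pow_left₀ (div_nonneg (Finset.sum_nonneg fun i _ => hz i) hh') ?_ _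
  exact div_le_div_of_nonneg_right hjK hh'

section TraceNorm

variable {E F : Type*} [NormedAddCommGroup E] [InnerProductSpace ℝ E]
  [NormedAddCommGroup F] [InnerProductSpace ℝ F]

/-- A rank one operator `a ⊗ b` pairs with two orthonormal families to at most `‖a‖ ‖b‖`. -/
theorem Orthonormal.sum_inner_mul_inner_le {ι : Type*} [Fintype ι] {w : ι → F} {v : ι → E}
    (hw : Orthonormal ℝ w) (hv : Orthonormal ℝ v) (a : F) (b : E) :
    ∑ i, inner ℝ b (v i) * inner ℝ (w i) a ≤ ‖a‖ * ‖b‖ := by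
  have h1 : ∑ i, inner ℝ b (v i) ^ 2 ≤ ‖b‖ ^ 2 := by
    simpa [real_inner_comm] using hv.sum_inner_products_le (s := Finset.univ) (x := b)
  have h2 : ∑ i, inner ℝ (w i) a ^ 2 ≤ ‖a‖ ^ 2 := by
    simpa using hw.sum_inner_products_le (s := Finset.univ) (x := a)
  refine (Real.sum_mul_le_sqrt_mul_sqrt _ _ _).trans ?_
  rw [mul_comm]
  exact mul_le_mul ((Real.sqrt_le_left (norm_nonneg _)).2 h2)
    ((Real.sqrt_le_left (norm_nonneg _)).2 h1) (Real.sqrt_nonneg _) (norm_nonneg _)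

variable [FiniteDimensional ℝ E] [FiniteDimensional ℝ F]

/-- The trace norm of `∑ k, p k • a k ⊗ b k` is at most `∑ k, p k * ‖a k‖ * ‖b k‖`. -/
theorem sum_sqrt_eigenvalues_le {ι κ : Type*} [Fintype ι] [Fintype κ] (T : E →ₗ[ℝ] F)
    (p : κ → ℝ) (hp : ∀ k, 0 ≤ p k) (a : κ → F) (b : κ → E)
    (hT : ∀ x, T x = ∑ k, (p k * inner ℝ (b k) x) • a k)
    (v : OrthonormalBasis ι ℝ E) (l : ι → ℝ)
    (hv : ∀ i, LinearMap.adjoint T (T (v i)) = l i • v i) :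
    ∑ i, Real.sqrt (l i) ≤ ∑ k, p k * (‖a k‖ * ‖b k‖) := by
  classical
  have hTT : ∀ i j, inner ℝ (T (v i)) (T (v j)) = if i = j then l i else 0 := by
    intro i j
    rw [← LinearMap.adjoint_inner_left, hv, real_inner_smul_left,
      orthonormal_iff_ite.1 v.orthonormal]
    simp
  have hl : ∀ i, 0 ≤ l i := fun i => by
    have := hTT i i
    rw [if_pos rfl] at this
    rw [← this]
    exact real_inner_self_nonneg
  -- The normalised images of the eigenvectors with nonzero eigenvalue are orthonormal.
  let w : {i // 0 < l i} → F := fun i => (Real.sqrt (l i))⁻¹ • T (v i)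
  have hw : Orthonormal ℝ w := by
    rw [orthonormal_iff_ite]
    intro i j
    simp only [w, real_inner_smul_left, real_inner_smul_right, hTT, Subtype.ext_iff]
    split_ifs with hij
    · have h1 := Real.sqrt_pos.2 i.2
      rw [← hij]
      field_simp
      exact (Real.sq_sqrt (hl i)).symm
    · simp
  have hv' : Orthonormal ℝ fun i : {i // 0 < l i} => v i :=
    v.orthonormal.comp _ Subtype.val_injective
  have hsqrt : ∀ i : {i // 0 < l i}, Real.sqrt (l i) = inner ℝ (w i) (T (v i)) := by
    intro i
    have h1 := Real.sqrt_pos.2 i.2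
    simp only [w, real_inner_smul_left, hTT, if_true]
    field_simp
    exact Real.sq_sqrt (hl i)
  calc ∑ i, Real.sqrt (l i) = ∑ i : {i // 0 < l i}, Real.sqrt (l i) := by
        rw [← Fintype.sum_subtype_add_sum_subtype (fun i => 0 < l i), add_eq_left]
        exact Finset.sum_eq_zero fun i _ => Real.sqrt_eq_zero'.2 (not_lt.1 i.2)
    _ = ∑ k, p k * ∑ i : {i // 0 < l i}, inner ℝ (b k) (v i) * inner ℝ (w i) (a k) := by
        simp_rw [hsqrt, hT, inner_sum, real_inner_smul_right, Finset.mul_sum]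
        rw [Finset.sum_comm]
        simp_rw [mul_assoc]
    _ ≤ ∑ k, p k * (‖a k‖ * ‖b k‖) := Finset.sum_le_sum fun k _ =>
        mul_le_mul_of_nonneg_left (hw.sum_inner_mul_inner_le hv' _ _) (hp k)

theorem exists_eigenvalue_eq_of_adjoint_apply_apply {ι : Type*} [Fintype ι] (T : E →ₗ[ℝ] F)
    (v : OrthonormalBasis ι ℝ E) (l : ι → ℝ)
    (hv : ∀ i, LinearMap.adjoint T (T (v i)) = l i • v i) (t : E) (ht : t ≠ 0) (c : ℝ)
    (htc : LinearMap.adjoint T (T t) = c • t) : ∃ i, l i = c := by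
  obtain ⟨i, hi⟩ : ∃ i, inner ℝ (v i) t ≠ 0 := by
    by_contra! hcon
    exact ht (by rw [← v.sum_repr' t]; simp [hcon])
  refine ⟨i, mul_right_cancel₀ hi ?_⟩
  rw [← real_inner_smul_left, ← hv, ← real_inner_smul_right, ← htc, LinearMap.adjoint_inner_left,
    LinearMap.adjoint_inner_right]

end TraceNorm

/-! ### Matrices with a distinguished singular pair -/

/-- Let `M = s ⊗ t + ∑ k, p k • a k ⊗ b k` with `a k ⟂ s` and `b k ⟂ t`. Then `‖s‖ * ‖t‖` is a
singular value of `M` and the others have sum at most `K = ∑ k, p k * ‖a k‖ * ‖b k‖`; if moreover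
`K ≤ h * ‖s‖ * ‖t‖`, the largest product of `h` singular values is estimated as if it had
`‖s‖ * ‖t‖` as a factor. -/
theorem schattenNorm_top_compoundMatrix_le_of_orthogonal {m n : ℕ} {κ : Type*} [Fintype κ]
    (M : Matrix (Fin m) (Fin n) ℝ) (s : EuclideanSpace ℝ (Fin m)) (t : EuclideanSpace ℝ (Fin n))
    (p : κ → ℝ) (hp : ∀ k, 0 ≤ p k) (a : κ → EuclideanSpace ℝ (Fin m))
    (b : κ → EuclideanSpace ℝ (Fin n))
    (hM : ∀ x, Matrix.toEuclideanLin M x =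
      inner ℝ t x • s + ∑ k, (p k * inner ℝ (b k) x) • a k)
    (ha : ∀ k, inner ℝ s (a k) = 0) (hb : ∀ k, inner ℝ (b k) t = 0) (ht : t ≠ 0)
    (K : ℝ) (hK : ∑ k, p k * (‖a k‖ * ‖b k‖) ≤ K) (h : ℕ) (hh : 1 ≤ h)
    (hKh : K ≤ ‖s‖ * ‖t‖ * h) :
    schattenNorm ⊤ (compoundMatrix h M) ≤
      ‖s‖ * ‖t‖ * (K / ((h : ℝ) - 1)) ^ (h - 1) := by
  have hn : Module.finrank ℝ (EuclideanSpace ℝ (Fin n)) = n := by simp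
  set T := Matrix.toEuclideanLin M with hTdef
  let v := T.isSymmetric_adjoint_comp_self.eigenvectorBasis hn
  let l := T.isSymmetric_adjoint_comp_self.eigenvalues hn
  have hv : ∀ i, LinearMap.adjoint T (T (v i)) = l i • v i := fun i =>
    T.isSymmetric_adjoint_comp_self.apply_eigenvectorBasis hn i
  have hl : ∀ i, 0 ≤ l i := T.isPositive_adjoint_comp_self.nonneg_eigenvalues hn
  have htrace : ∑ i, Real.sqrt (l i) ≤ ‖s‖ * ‖t‖ + K := by
    have := sum_sqrt_eigenvalues_le T (fun k : Option κ => k.elim 1 p)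
      (by rintro (_ | k); exacts [zero_le_one, hp k]) (fun k => k.elim s a) (fun k => k.elim t b)
      (fun x => by rw [hM, Fintype.sum_option]; simp) v l hv
    rw [Fintype.sum_option] at this
    simp only [Option.elim, one_mul] at this
    linarith
  have hTt : T t = ‖t‖ ^ 2 • s := by
    rw [hM]
    simp [hb]
  have hTs : LinearMap.adjoint T s = ‖s‖ ^ 2 • t := by
    refine ext_inner_right ℝ fun x => ?_
    rw [LinearMap.adjoint_inner_left, hM, inner_add_right, inner_sum]
    simp only [real_inner_smul_right, real_inner_smul_left, ha, mul_zero,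
      Finset.sum_const_zero, add_zero, real_inner_self_eq_norm_sq]
    ring
  obtain ⟨i₀, hi₀⟩ := exists_eigenvalue_eq_of_adjoint_apply_apply T v l hv t ht
    ((‖s‖ * ‖t‖) ^ 2) (by
      rw [hTt, map_smul, hTs, smul_smul]
      ring_nf)
  have hK0 : 0 ≤ K := le_trans (Finset.sum_nonneg fun k _ =>
    mul_nonneg (hp k) (mul_nonneg (norm_nonneg _) (norm_nonneg _))) hK
  have hh' : (0 : ℝ) ≤ (h : ℝ) - 1 := by
    have : (1 : ℝ) ≤ h := by exact_mod_cast hh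
    linarith
  refine schattenNorm_top_compoundMatrix_le h M v l hv _ (by positivity) fun S hS => ?_
  have hprod := prod_le_mul_div_pow (fun i => Real.sqrt (l i)) (fun i => Real.sqrt_nonneg _)
    (‖s‖ * ‖t‖) K i₀ (by rw [hi₀, Real.sqrt_sq (by positivity)]) htrace h hh hKh S hS
  have hsq : ∏ i ∈ S, l i = (∏ i ∈ S, Real.sqrt (l i)) ^ 2 := by
    rw [← Finset.prod_pow]
    exact Finset.prod_congr rfl fun i _ => (Real.sq_sqrt (hl i)).symm
  rw [hsq]
  exact pow_le_pow_left₀ (Finset.prod_nonneg fun i _ => Real.sqrt_nonneg _) hprod 2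

/-! ### Coordinates of Hermitian matrices and separable states in filter normal form -/

/-- The coordinates `tr (X (A i))` of a matrix `X` in a Hermitian orthonormal basis `A`; for
Hermitian `X` these traces are real. -/
noncomputable def hermitianCoords {d : ℕ} (A : Fin (d ^ 2) → Matrix (Fin d) (Fin d) ℂ)
    (X : Matrix (Fin d) (Fin d) ℂ) : EuclideanSpace ℝ (Fin (d ^ 2)) :=
  WithLp.toLp 2 fun i => (X * A i).trace.re

/-- The maximally mixed state `1 / d`. -/
noncomputable def maximallyMixed (d : ℕ) : Matrix (Fin d) (Fin d) ℂ :=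
  (d : ℂ)⁻¹ • 1

theorem maximallyMixed_isHermitian (d : ℕ) : (maximallyMixed d).IsHermitian := by
  simp [maximallyMixed, Matrix.IsHermitian, Matrix.conjTranspose_smul]

theorem Matrix.IsHermitian.im_trace_mul_eq_zero {d : ℕ} {X Y : Matrix (Fin d) (Fin d) ℂ}
    (hX : X.IsHermitian) (hY : Y.IsHermitian) : (X * Y).trace.im = 0 := by
  rw [← Complex.conj_eq_iff_im]
  change star _ = _
  rw [← Matrix.trace_conjTranspose, Matrix.conjTranspose_mul, hX.eq, hY.eq, Matrix.trace_mul_comm]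

theorem hermitianCoords_sub {d : ℕ} (A : Fin (d ^ 2) → Matrix (Fin d) (Fin d) ℂ)
    (X Y : Matrix (Fin d) (Fin d) ℂ) :
    hermitianCoords A (X - Y) = hermitianCoords A X - hermitianCoords A Y := by
  ext i
  simp [hermitianCoords, Matrix.sub_mul]

/-- Parseval's identity for the Hilbert–Schmidt inner product. -/
theorem inner_hermitianCoords {d : ℕ} {A : Fin (d ^ 2) → Matrix (Fin d) (Fin d) ℂ}
    (hA : IsHermitianONB A) {X Y : Matrix (Fin d) (Fin d) ℂ} (hX : X.IsHermitian) :
    inner ℝ (hermitianCoords A X) (hermitianCoords A Y) = (X * Y).trace.re := by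
  obtain ⟨-, horth, hspan⟩ := hA
  have hmem : X ∈ Submodule.span ℝ (Set.range A) := by
    rw [hspan]
    exact hX
  obtain ⟨c, rfl⟩ := (Submodule.mem_span_range_iff_exists_fun ℝ).1 hmem
  have hc : ∀ j, ((∑ i, c i • A i) * A j).trace.re = c j := by
    intro j
    simp only [Matrix.sum_mul, Matrix.smul_mul, Matrix.trace_sum, Matrix.trace_smul, horth,
      Complex.re_sum, Complex.smul_re, smul_eq_mul]
    rw [Finset.sum_eq_single j] <;> simp +contextual
  simp only [hermitianCoords, PiLp.inner_apply, hc]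
  simp only [Matrix.sum_mul, Matrix.smul_mul, Matrix.trace_sum, Matrix.trace_smul,
    Complex.re_sum, Complex.smul_re, smul_eq_mul, Matrix.trace_mul_comm Y]
  simp [mul_comm]

/-- The purity of a state is at most one. -/
theorem IsState.re_trace_mul_self_le_one {d : ℕ} {O : Matrix (Fin d) (Fin d) ℂ}
    (hO : IsState O) : (O * O).trace.re ≤ 1 := by
  obtain ⟨hpos, htr⟩ := hO
  have hH := hpos.isHermitian
  have h1 : ∑ i, hH.eigenvalues i = 1 := by
    have := hH.trace_eq_sum_eigenvalues
    rw [htr] at this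
    simpa using (congrArg Complex.re this).symm
  have h2 : (O * O).trace = ∑ i, ((hH.eigenvalues i ^ 2 : ℝ) : ℂ) := by
    conv_lhs => rw [hH.spectral_theorem]
    rw [← map_mul, Unitary.conjStarAlgAut_apply, Matrix.trace_mul_comm, ← mul_assoc]
    simp [Matrix.trace_diagonal, sq]
  rw [h2, ← Complex.ofReal_sum, Complex.ofReal_re]
  calc ∑ i, hH.eigenvalues i ^ 2 ≤ (∑ i, hH.eigenvalues i) ^ 2 :=
        Finset.sum_sq_le_sq_sum_of_nonneg fun i _ => hpos.eigenvalues_nonneg i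
    _ = 1 := by rw [h1, one_pow]

theorem inner_hermitianCoords_maximallyMixed {d : ℕ}
    {A : Fin (d ^ 2) → Matrix (Fin d) (Fin d) ℂ} (hA : IsHermitianONB A)
    (X : Matrix (Fin d) (Fin d) ℂ) :
    inner ℝ (hermitianCoords A (maximallyMixed d)) (hermitianCoords A X) =
      (d : ℝ)⁻¹ * X.trace.re := by
  rw [inner_hermitianCoords hA (maximallyMixed_isHermitian d)]
  simp [maximallyMixed]

theorem trace_maximallyMixed {d : ℕ} (hd : d ≠ 0) : (maximallyMixed d).trace = 1 := by
  simp [maximallyMixed, hd]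

theorem norm_hermitianCoords_maximallyMixed {d : ℕ} (hd : d ≠ 0)
    {A : Fin (d ^ 2) → Matrix (Fin d) (Fin d) ℂ} (hA : IsHermitianONB A) :
    ‖hermitianCoords A (maximallyMixed d)‖ = Real.sqrt ((d : ℝ)⁻¹) := by
  rw [norm_eq_sqrt_real_inner, inner_hermitianCoords_maximallyMixed hA, trace_maximallyMixed hd]
  simp

theorem inner_maximallyMixed_hermitianCoords_sub {d : ℕ} (hd : d ≠ 0)
    {A : Fin (d ^ 2) → Matrix (Fin d) (Fin d) ℂ} (hA : IsHermitianONB A)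
    {O : Matrix (Fin d) (Fin d) ℂ} (hO : IsState O) :
    inner ℝ (hermitianCoords A (maximallyMixed d))
      (hermitianCoords A (O - maximallyMixed d)) = 0 := by
  rw [inner_hermitianCoords_maximallyMixed hA, Matrix.trace_sub, hO.2, trace_maximallyMixed hd]
  simp

/-- The Bloch vector of a state has squared length at most `1 - 1 / d`. -/
theorem norm_hermitianCoords_sub_maximallyMixed_le {d : ℕ} (hd : d ≠ 0)
    {A : Fin (d ^ 2) → Matrix (Fin d) (Fin d) ℂ} (hA : IsHermitianONB A)
    {O : Matrix (Fin d) (Fin d) ℂ} (hO : IsState O) :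
    ‖hermitianCoords A (O - maximallyMixed d)‖ ≤ Real.sqrt (1 - (d : ℝ)⁻¹) := by
  have h0 := inner_maximallyMixed_hermitianCoords_sub hd hA hO
  have hnorm := norm_hermitianCoords_maximallyMixed hd hA
  have hpyth : ‖hermitianCoords A O‖ ^ 2 = ‖hermitianCoords A (maximallyMixed d)‖ ^ 2 +
      ‖hermitianCoords A (O - maximallyMixed d)‖ ^ 2 := by
    have := norm_add_sq_real (hermitianCoords A (maximallyMixed d))
      (hermitianCoords A (O - maximallyMixed d))
    rw [h0, hermitianCoords_sub, add_sub_cancel] at this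
    rw [hermitianCoords_sub, this]
    ring
  have hO1 : ‖hermitianCoords A O‖ ^ 2 ≤ 1 := by
    rw [← real_inner_self_eq_norm_sq, inner_hermitianCoords hA hO.1.isHermitian]
    exact hO.re_trace_mul_self_le_one
  rw [hnorm, Real.sq_sqrt (by positivity)] at hpyth
  exact Real.le_sqrt_of_sq_le (by linarith)

theorem IsSeparableState.dim_ne_zero {dA dB : ℕ}
    {ρ : Matrix (Fin dA × Fin dB) (Fin dA × Fin dB) ℂ} (hρ : IsSeparableState ρ) :
    dA ≠ 0 ∧ dB ≠ 0 := by
  obtain ⟨n, p, O, Q, -, hp1, hO, hQ, -⟩ := hρ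
  obtain ⟨k⟩ : Nonempty (Fin n) := by
    by_contra hne
    rw [not_nonempty_iff] at hne
    simp at hp1
  constructor
  · rintro rfl
    simpa [Matrix.trace] using (hO k).2
  · rintro rfl
    simpa [Matrix.trace] using (hQ k).2

theorem expectation_sum_kronecker {dA dB n : ℕ} (p : Fin n → ℝ)
    (O : Fin n → Matrix (Fin dA) (Fin dA) ℂ) (Q : Fin n → Matrix (Fin dB) (Fin dB) ℂ)
    (X : Matrix (Fin dA) (Fin dA) ℂ) (Y : Matrix (Fin dB) (Fin dB) ℂ) :
    expectation (∑ k, (p k : ℂ) • (O k ⊗ₖ Q k)) (X ⊗ₖ Y) =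
      ∑ k, (p k : ℂ) * ((O k * X).trace * (Q k * Y).trace) := by
  simp only [expectation, Matrix.sum_mul, Matrix.smul_mul, Matrix.trace_sum, Matrix.trace_smul,
    ← Matrix.mul_kronecker_mul, Matrix.trace_kronecker, smul_eq_mul]

/-- If a mixture of states has the expectation values of the maximally mixed state on all traceless
Hermitian observables, then its coordinate vector is that of the maximally mixed state. -/
theorem sum_smul_hermitianCoords_sub_maximallyMixed {d n : ℕ} (hd : d ≠ 0)
    {A : Fin (d ^ 2) → Matrix (Fin d) (Fin d) ℂ} (hA : IsHermitianONB A) (p : Fin n → ℝ)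
    (O : Fin n → Matrix (Fin d) (Fin d) ℂ) (hO : ∀ k, IsState (O k))
    (hfnf : ∀ X : Matrix (Fin d) (Fin d) ℂ, X.IsHermitian → X.trace = 0 →
      ∑ k, (p k : ℂ) * (O k * X).trace = 0) :
    ∑ k, p k • hermitianCoords A (O k - maximallyMixed d) = 0 := by
  ext i
  have him : (A i).trace.im = 0 := by
    have := (hA.1 i).im_trace_mul_eq_zero (Matrix.isHermitian_one (n := Fin d) (α := ℂ))
    rwa [Matrix.mul_one] at this
  have hreal : star (A i).trace = (A i).trace := Complex.conj_eq_iff_im.2 him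
  have hX : (A i - (A i).trace • maximallyMixed d).IsHermitian := by
    rw [Matrix.IsHermitian, Matrix.conjTranspose_sub, Matrix.conjTranspose_smul, hreal,
      (hA.1 i).eq, (maximallyMixed_isHermitian d).eq]
  have h0 := hfnf _ hX (by
    rw [Matrix.trace_sub, Matrix.trace_smul, trace_maximallyMixed hd, smul_eq_mul, mul_one,
      sub_self])
  have hk : ∀ k, (O k * (A i - (A i).trace • maximallyMixed d)).trace =
      ((O k - maximallyMixed d) * A i).trace := by
    intro k
    simp only [maximallyMixed, Matrix.mul_sub, Matrix.sub_mul, Matrix.trace_sub, Matrix.mul_smul,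
      Matrix.smul_mul, Matrix.trace_smul, Matrix.mul_one, Matrix.one_mul, (hO k).2, smul_eq_mul]
    ring
  simp only [hk] at h0
  have h1 := congrArg Complex.re h0
  simpa [hermitianCoords] using h1

/-- The correlation matrix of a separable state in filter normal form is the rank one matrix coming
from the maximally mixed states plus the mixture of the products of the Bloch vectors. -/
theorem correlationMatrix_apply_of_isFNF {dA dB n : ℕ} (hdA : dA ≠ 0) (hdB : dB ≠ 0)
    (p : Fin n → ℝ) (O : Fin n → Matrix (Fin dA) (Fin dA) ℂ)
    (Q : Fin n → Matrix (Fin dB) (Fin dB) ℂ) (hp1 : ∑ k, p k = 1)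
    (hO : ∀ k, IsState (O k)) (hQ : ∀ k, IsState (Q k))
    (hfnf : IsFNF (∑ k, (p k : ℂ) • (O k ⊗ₖ Q k)))
    {A : Fin (dA ^ 2) → Matrix (Fin dA) (Fin dA) ℂ} (hA : IsHermitianONB A)
    {B : Fin (dB ^ 2) → Matrix (Fin dB) (Fin dB) ℂ} (hB : IsHermitianONB B)
    (x : EuclideanSpace ℝ (Fin (dB ^ 2))) :
    Matrix.toEuclideanLin (correlationMatrix (∑ k, (p k : ℂ) • (O k ⊗ₖ Q k)) A B) x =
      inner ℝ (hermitianCoords B (maximallyMixed dB)) x • hermitianCoords A (maximallyMixed dA) +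
      ∑ k, (p k * inner ℝ (hermitianCoords B (Q k - maximallyMixed dB)) x) •
        hermitianCoords A (O k - maximallyMixed dA) := by
  have ha : ∑ k, p k • hermitianCoords A (O k - maximallyMixed dA) = 0 :=
    sum_smul_hermitianCoords_sub_maximallyMixed hdA hA p O hO fun X hX hX0 => by
      have := hfnf.1 X hX hX0
      rw [expectation_sum_kronecker] at this
      simpa [(hQ _).2] using this
  have hb : ∑ k, p k • hermitianCoords B (Q k - maximallyMixed dB) = 0 :=
    sum_smul_hermitianCoords_sub_maximallyMixed hdB hB p Q hQ fun X hX hX0 => by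
      have := hfnf.2 X hX hX0
      rw [expectation_sum_kronecker] at this
      simpa [(hO _).2] using this
  have hprod : Matrix.toEuclideanLin
      (correlationMatrix (∑ k, (p k : ℂ) • (O k ⊗ₖ Q k)) A B) x =
      ∑ k, (p k * inner ℝ (hermitianCoords B (Q k)) x) • hermitianCoords A (O k) := by
    have hre : ∀ k i j, ((O k * A i).trace * (Q k * B j).trace).re =
        (O k * A i).trace.re * (Q k * B j).trace.re := by
      intro k i j
      rw [Complex.mul_re, (hO k).1.isHermitian.im_trace_mul_eq_zero (hA.1 i)]
      ring
    ext i
    simp only [Matrix.toLpLin_apply, correlationMatrix, expectation_sum_kronecker, Matrix.mulVec,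
      dotProduct, Matrix.of_apply, Complex.re_sum, Complex.re_ofReal_mul, hre, Finset.sum_mul,
      hermitianCoords, PiLp.inner_apply, WithLp.ofLp_sum, WithLp.ofLp_smul, Finset.sum_apply,
      Pi.smul_apply, smul_eq_mul, Finset.mul_sum, RCLike.inner_apply, conj_trivial]
    rw [Finset.sum_comm]
    refine Finset.sum_congr rfl fun k _ => Finset.sum_congr rfl fun j _ => ?_
    ring
  have hb' : ∑ k, p k * inner ℝ (hermitianCoords B (Q k - maximallyMixed dB)) x = 0 := by
    have := congrArg (fun y => inner ℝ y x) hb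
    simpa [sum_inner, real_inner_smul_left] using this
  rw [hprod]
  -- Expand around the maximally mixed states; the cross terms vanish by `ha` and `hb'`.
  have hsplit : ∀ k, (p k * inner ℝ (hermitianCoords B (Q k)) x) • hermitianCoords A (O k) =
      p k • (inner ℝ (hermitianCoords B (maximallyMixed dB)) x •
        hermitianCoords A (maximallyMixed dA)) +
      (p k * inner ℝ (hermitianCoords B (Q k - maximallyMixed dB)) x) •
        hermitianCoords A (maximallyMixed dA) +
      inner ℝ (hermitianCoords B (maximallyMixed dB)) x •
        (p k • hermitianCoords A (O k - maximallyMixed dA)) +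
      (p k * inner ℝ (hermitianCoords B (Q k - maximallyMixed dB)) x) •
        hermitianCoords A (O k - maximallyMixed dA) := by
    intro k
    rw [hermitianCoords_sub, hermitianCoords_sub, inner_sub_left]
    module
  simp only [hsplit, Finset.sum_add_distrib, ← Finset.sum_smul, ← Finset.smul_sum, hp1, hb', ha,
    one_smul, zero_smul, smul_zero, add_zero]

/-- The singular value `1 / √(dA dB)` belongs to the maximally mixed states, and the trace norm of
the Bloch vector part is at most `√(1 - 1 / dA) * √(1 - 1 / dB) ≤ 1 ≤ h / √(dA dB)`. The estimate
is symmetric in the two dimensions, so that their order plays no role. -/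
theorem correlationMinorNorm_top_le {dA dB h : ℕ}
    {ρ : Matrix (Fin dA × Fin dB) (Fin dA × Fin dB) ℂ}
    (hsep : IsSeparableState ρ) (hfnf : IsFNF ρ)
    {A : Fin (dA ^ 2) → Matrix (Fin dA) (Fin dA) ℂ} (hA : IsHermitianONB A)
    {B : Fin (dB ^ 2) → Matrix (Fin dB) (Fin dB) ℂ} (hB : IsHermitianONB B)
    (hh : Real.sqrt ((dA : ℝ) * (dB : ℝ)) ≤ (h : ℝ)) :
    correlationMinorNorm h ⊤ ρ A B ≤
      1 / Real.sqrt ((dA : ℝ) * (dB : ℝ)) *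
        ((((dA : ℝ) - 1) / ((dA : ℝ) * ((h : ℝ) - 1))) *
          (((dB : ℝ) - 1) / ((dB : ℝ) * ((h : ℝ) - 1)))) ^ (((h : ℝ) - 1) / 2) := by
  obtain ⟨hdA, hdB⟩ := hsep.dim_ne_zero
  obtain ⟨n, p, O, Q, hp, hp1, hO, hQ, rfl⟩ := hsep
  have hA1 : (1 : ℝ) ≤ dA := by exact_mod_cast Nat.one_le_iff_ne_zero.2 hdA
  have hB1 : (1 : ℝ) ≤ dB := by exact_mod_cast Nat.one_le_iff_ne_zero.2 hdB
  have hsqrt1 : 1 ≤ Real.sqrt ((dA : ℝ) * dB) := Real.one_le_sqrt.2 (by nlinarith)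
  have hh1 : 1 ≤ h := by exact_mod_cast hsqrt1.trans hh
  have hhr : (0 : ℝ) ≤ (h : ℝ) - 1 := by linarith
  set K := Real.sqrt (1 - (dA : ℝ)⁻¹) * Real.sqrt (1 - (dB : ℝ)⁻¹) with hKdef
  have hAi : (dA : ℝ)⁻¹ ≤ 1 := inv_le_one_of_one_le₀ hA1
  have hBi : (dB : ℝ)⁻¹ ≤ 1 := inv_le_one_of_one_le₀ hB1
  have hK1 : K ≤ 1 := mul_le_one₀ (Real.sqrt_le_one.2 (by simp)) (Real.sqrt_nonneg _)
    (Real.sqrt_le_one.2 (by simp))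
  have hc : ‖hermitianCoords A (maximallyMixed dA)‖ * ‖hermitianCoords B (maximallyMixed dB)‖ =
      1 / Real.sqrt ((dA : ℝ) * (dB : ℝ)) := by
    rw [norm_hermitianCoords_maximallyMixed hdA hA, norm_hermitianCoords_maximallyMixed hdB hB,
      ← Real.sqrt_mul (by positivity), ← mul_inv, Real.sqrt_inv, one_div]
  have hbound := schattenNorm_top_compoundMatrix_le_of_orthogonal _ _ _ p hp _ _
    (correlationMatrix_apply_of_isFNF hdA hdB p O Q hp1 hO hQ hfnf hA hB)
    (fun k => inner_maximallyMixed_hermitianCoords_sub hdA hA (hO k))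
    (fun k => by
      rw [real_inner_comm]
      exact inner_maximallyMixed_hermitianCoords_sub hdB hB (hQ k))
    (by
      rw [← norm_ne_zero_iff, norm_hermitianCoords_maximallyMixed hdB hB]
      positivity)
    K
    (calc _ ≤ ∑ k, p k * K := Finset.sum_le_sum fun k _ =>
            mul_le_mul_of_nonneg_left (mul_le_mul
              (norm_hermitianCoords_sub_maximallyMixed_le hdA hA (hO k))
              (norm_hermitianCoords_sub_maximallyMixed_le hdB hB (hQ k))
              (norm_nonneg _) (Real.sqrt_nonneg _)) (hp k)
      _ = K := by rw [← Finset.sum_mul, hp1, one_mul])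
    h hh1
    (by
      rw [hc]
      refine hK1.trans ?_
      rw [one_div, ← div_eq_inv_mul, one_le_div (by linarith)]
      exact hh)
  refine hbound.trans_eq ?_
  rw [hc]
  congr 1
  have hdiv : ∀ y : ℝ, 1 ≤ y → (y - 1) / y = 1 - y⁻¹ := fun y hy => by
    rw [sub_div, div_self (by linarith), one_div]
  -- For `h = 1` both sides are `0`, as division by zero gives zero.
  have hKsq : (((dA : ℝ) - 1) / ((dA : ℝ) * ((h : ℝ) - 1))) *
      (((dB : ℝ) - 1) / ((dB : ℝ) * ((h : ℝ) - 1))) = (K / ((h : ℝ) - 1)) ^ 2 := by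
    rw [div_pow, hKdef, mul_pow, Real.sq_sqrt (by linarith), Real.sq_sqrt (by linarith),
      ← div_div, ← div_div, hdiv _ hA1, hdiv _ hB1,
      div_mul_div_comm, ← sq]
  have hK0 : 0 ≤ K / ((h : ℝ) - 1) := div_nonneg (by positivity) hhr
  have hcast : (h : ℝ) - 1 = ((h - 1 : ℕ) : ℝ) := by push_cast [hh1]; rfl
  rw [hKsq, ← Real.rpow_natCast _ 2, ← Real.rpow_mul hK0, ← Real.rpow_natCast, ← hcast]
  congr 1
  push_cast
  ring

theorem theorem3 (dA dB D d h : ℕ) (hD : D = max dA dB) (hd : d = min dA dB)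
    (ρ : Matrix (Fin dA × Fin dB) (Fin dA × Fin dB) ℂ)
    (hsep : IsSeparableState ρ) (hfnf : IsFNF ρ)
    (A : Fin (dA ^ 2) → Matrix (Fin dA) (Fin dA) ℂ) (hA : IsHermitianONB A)
    (B : Fin (dB ^ 2) → Matrix (Fin dB) (Fin dB) ℂ) (hB : IsHermitianONB B)
    (h_le : h ≤ d ^ 2) (h_ge : Real.sqrt ((D : ℝ) * (d : ℝ)) ≤ (h : ℝ)) :
    correlationMinorNorm h ⊤ ρ A B ≤
      1 / Real.sqrt ((D : ℝ) * (d : ℝ)) *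
        ((((D : ℝ) - 1) / ((D : ℝ) * ((h : ℝ) - 1))) *
          (((d : ℝ) - 1) / ((d : ℝ) * ((h : ℝ) - 1)))) ^ (((h : ℝ) - 1) / 2) := by
  rcases le_total dA dB with hle | hle
  · rw [max_eq_right hle] at hD
    rw [min_eq_left hle] at hd
    subst hD hd
    rw [mul_comm (D : ℝ) (d : ℝ), mul_comm (((D : ℝ) - 1) / _)]
    rw [mul_comm (D : ℝ) (d : ℝ)] at h_ge
    exact correlationMinorNorm_top_le hsep hfnf hA hB h_ge
  · rw [max_eq_left hle] at hD
    rw [min_eq_right hle] at hd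
    subst hD hd
    exact correlationMinorNorm_top_le hsep hfnf hA hB h_ge
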